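/- **Setting.** Let $V$ be a finite set of network IDs (nodes), $|V|\le\bar V$, $W$ a set of logical IDs, and $\mathtt{NID}:W\to V$ a map unknown to the agent. An additional node $a$, the agent, has at most $k\ge 2$ peers at a time. Everything below may be random, except for $\mathtt{NID}$ and the link distances. * *Topology.* At time $t\ge 0$ there are a set $V(t)\subseteq V$ of present nodes and an undirected graph $E(t)$ on $V(t)$, both varying arbitrarily. Link distances $w(u,v)$, $u,v\in V\cup\{a\}$, are constant in time, satisfy $0<w(u,v)\le \bar w$ for $u\ne v$, and $w(u,v)\le w(u,z)+w(z,v)$. * *Dissemination.* A message with logical ID $x\in W$ is broadcast by $\mathtt{NID}(x)$. Each node other than $a$ forwards a message, at the moment of its first receipt, to all its neighbours of that moment (the agent included); sent from $u$ to $v$ at time $t$, it arrives at time $t+w(u,v)$. The agent forwards nothing. For every message delivered to it, the agent sees which message it is, the logical ID of its sender, the delivering peer $p$, the time of arrival, and its link distance $w(p,a)$. * *Oracle.* The oracle answers one query of the agent per time $\tau>0$. Conditionally on the past, every node present at the time of the answer is drawn with probability at least $q>0$; the answer is a present node. The agent can send peering requests only to nodes that the oracle has named, and chooses the set of (at most $k$)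 nodes to which it sends requests anew at the times $0,\tau,2\tau,\dots$, from what it has seen before. * *Slots.* Every node has at least $F\ge 1$ dynamic slots. Each slot carries at most one connection at a time; every connection of another node in a dynamic slot is an edge of the network while it lasts, and has an $\mathrm{Exp}(\lambda)$ duration independent of the time at which it is established. Slots are permissionless and served first come, first served, and the agent repeats its requests without pause: if the agent requests a present node $v$ throughout $[s,t]$, it is connected to $v$ at time $t$ unless every dynamic slot of $v$ is occupied by one and the same other connection throughout $[s,t]$. * *Targets and activity.* The targets are given by a finite set $U\subseteq W$ on which $\mathtt{NID}$ is injective, so that $|U|$ is the number of target nodes; these are present at all times. For $x\in U$ the process $M_x(t)$, which counts the messages of $x$ broadcast up to time $t$, is finite for all $t$ and satisfies $$\mathbb P\big[M_x(t+\Delta)-M_x(t)<\gamma\Delta\big]<\frac{\mu}{\Delta}\qquad\text{for all } t,\Delta>0,$$ with constants $\gamma,\mu>0$. A network with these properties is called *quasi-live* (with constants $\bar V,k,F,\lambda,\gamma,\mu,q,\tau,\bar w$). **Theorem.** For all constants $\bar V,k,F,\lambda,\gamma,\mu,q,\tau,\bar w$ as above and every $\epsilon_0\in(0,1)$ there is a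 constant $K>0$ such that for all finite $V$ with $|V|\le\bar V$, all $W$, all finite $U\subseteq W$ and all $\epsilon\in(0,\epsilon_0]$, there are a strategy of the agent and a time $$T\le K\,|U|^2\,\epsilon^{-1}\log^2(\epsilon^{-1})$$ such that in every quasi-live network with these constants and with targets $U$, an agent who follows this strategy knows at time $T$, with probability at least $1-\epsilon$, the network IDs $\mathtt{NID}(x)$ of all $x\in U$. -/

import Mathlib

open MeasureTheory ProbabilityTheory
open scoped ENNReal

namespace PeerNet

/-- The constants of the model. -/
structure Params where
  /-- upper bound on the number of network IDs -/
  maxNodes : ℕ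
  /-- maximal number of simultaneous peers of the agent -/
  maxPeers : ℕ
  /-- every node has (at least) this many dynamic peer slots -/
  slots : ℕ
  /-- rate of the exponential durations of dynamic connections -/
  lam : ℝ
  /-- the two constants of the activity condition -/
  gam : ℝ
  mu : ℝ
  /-- lower bound on the probability with which the oracle draws a given present node -/
  q : ℝ
  /-- time the oracle needs to answer one query -/
  tau : ℝ
  /-- upper bound on the link distances -/
  wmax : ℝ
  two_le_maxPeers : 2 ≤ maxPeers
  slots_pos : 0 < slots
  lam_pos : 0 < lam
  gam_pos : 0 < gam
  mu_pos : 0 < mu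
  q_pos : 0 < q
  tau_pos : 0 < tau
  wmax_pos : 0 < wmax

/-- What the agent records when one of its peers delivers a message to it: the logical ID of the
sender, the identity of the message, the delivering peer, the time of arrival, and the
link distance from that peer to the agent. -/
structure Arrival (V W : Type*) where
  sender : W
  msg : ℕ
  peer : V
  time : ℝ
  link : ℝ

/-- The information available to the agent at some moment: the oracle's answers in order, the
messages delivered to it, and the log of its peer connections. -/
structure View (V W : Type*) where
  answers : List V
  arrivals : Set (Arrival V W)
  peerLog : Set (V × ℝ)

/-- A strategy of the agent with at most `k` peers. From what it has seen it decides
to which nodes it keeps sending peering requests (holding the connection once it has it), and what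
it believes to be the network ID behind each logical ID. It can only address nodes whose
network IDs it was told by the oracle. -/
structure Strategy (V W : Type*) (k : ℕ) where
  request : View V W → Finset V
  output : View V W → W → Option V
  request_known : ∀ I, ∀ v ∈ request I, v ∈ I.answers
  request_card : ∀ I, (request I).card ≤ k

/-- A random evolution of the network together with the agent. `V` is the set of network IDs of
the nodes other than the agent, `W` the set of logical IDs, `C` labels the dynamic connections
between such nodes, `F` is the number of dynamic slots of a node. -/
structure Run (V W C Ω : Type*) (F : ℕ) where
  /-- the network ID behind a logical ID -/
  nid : W → V
  /-- the nodes present at time `t` -/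
  nodes : ℝ → Ω → Set V
  /-- the peer connections between non-agent nodes at time `t` -/
  graph : ℝ → Ω → SimpleGraph V
  /-- link distances; `none` stands for the agent -/
  dist : Option V → Option V → ℝ
  /-- `oracle n` is the answer to the agent's query number `n` -/
  oracle : ℕ → Ω → V
  /-- connection `c` occupies the dynamic slot `slot c` of `host c` and joins it to `guest c` -/
  host : C → V
  slot : C → Fin F
  guest : C → Ω → V
  /-- time at which `c` is established (`⊤`: never) -/
  start : C → Ω → ℝ≥0∞
  dur : C → Ω → ℝ
  /-- time at which message number `n` signed by `w` is broadcast by `nid w` (`⊤`: never) -/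
  sent : W → ℕ → Ω → ℝ≥0∞
  /-- time at which that message first reaches a node (`⊤`: never) -/
  recv : W → ℕ → V → Ω → ℝ≥0∞
  /-- the peers of the agent at time `t` -/
  peers : ℝ → Ω → Set V

namespace Run

variable {V W C Ω : Type*} {F : ℕ}

/-- Connection `c` is up during the whole of `[s, t]`. -/
def Holds (R : Run V W C Ω F) (c : C) (s t : ℝ) (ω : Ω) : Prop :=
  R.start c ω ≤ ENNReal.ofReal s ∧
    ENNReal.ofReal t < R.start c ω + ENNReal.ofReal (R.dur c ω)

/-- The counting process of the messages signed by `w`. -/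
noncomputable def count (R : Run V W C Ω F) (w : W) (t : ℝ) (ω : Ω) : ℕ :=
  {n : ℕ | R.sent w n ω ≤ ENNReal.ofReal t}.ncard

/-- A peer `p` of the agent forwards a message to the agent at the moment at which it
first receives it (provided that they are connected at that moment); it arrives
`dist p agent` later. -/
def Delivers (R : Run V W C Ω F) (ω : Ω) (a : Arrival V W) : Prop :=
  R.recv a.sender a.msg a.peer ω ≠ ⊤ ∧
  a.peer ∈ R.peers (R.recv a.sender a.msg a.peer ω).toReal ω ∧
  a.link = R.dist (some a.peer) none ∧
  a.time = (R.recv a.sender a.msg a.peer ω).toReal + a.link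

/-- What the agent has seen when the clock reaches `n * τ`: the answers to its first `n` queries
(the agent queries the oracle all the time, so that answer number `i` comes at time
`(i + 1) * τ`), and everything that happened at its node before time `n * τ`. -/
def view (R : Run V W C Ω F) (τ : ℝ) (n : ℕ) (ω : Ω) : View V W where
  answers := (List.range n).map fun i => R.oracle i ω
  arrivals := {a | R.Delivers ω a ∧ a.time < n * τ}
  peerLog := {x | 0 ≤ x.2 ∧ x.2 < n * τ ∧ x.1 ∈ R.peers x.2 ω}

/-- The nodes that the agent is requesting at time `t` when it plays `σ`; it reconsiders its
choice whenever the oracle answers. -/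
noncomputable def requested (R : Run V W C Ω F) (τ : ℝ) {k : ℕ} (σ : Strategy V W k)
    (t : ℝ) (ω : Ω) : Finset V :=
  σ.request (R.view τ ⌊t / τ⌋₊ ω)

/-- Message number `n` of `w` is disseminated by flooding: every non-agent node forwards
it, at the moment of its first receipt, to all its neighbours of that moment. The agent does not
forward messages. -/
def Floods (R : Run V W C Ω F) (w : W) (n : ℕ) (ω : Ω) : Prop :=
  R.recv w n (R.nid w) ω = R.sent w n ω ∧
  ∀ v, v ≠ R.nid w →
    R.recv w n v ω =
      ⨅ (u : V) (_ : R.recv w n u ω ≠ ⊤ ∧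
          (R.graph (R.recv w n u ω).toReal ω).Adj u v),
        R.recv w n u ω + ENNReal.ofReal (R.dist (some u) (some v))

/-- The rules of the network that hold along one sample path, when the agent plays `σ` and the
targets are the nodes behind the logical IDs in `U`. -/
structure PathRules (R : Run V W C Ω F) (τ : ℝ) {k : ℕ} (σ : Strategy V W k)
    (U : Finset W) (ω : Ω) : Prop where
  target_mem : ∀ w ∈ U, ∀ t, 0 ≤ t → R.nid w ∈ R.nodes t ω
  adj_mem : ∀ t, 0 ≤ t → ∀ u v, (R.graph t ω).Adj u v → u ∈ R.nodes t ω ∧ v ∈ R.nodes t ω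
  oracle_mem : ∀ n : ℕ, R.oracle n ω ∈ R.nodes ((n + 1) * τ) ω
  /-- a dynamic connection is an edge of the network as long as it lasts -/
  dynamic_adj : ∀ c t, 0 ≤ t → R.Holds c t t ω → (R.graph t ω).Adj (R.host c) (R.guest c ω)
  /-- a dynamic slot carries at most one connection at a time -/
  slot_excl : ∀ c d t, 0 ≤ t → R.host c = R.host d → R.slot c = R.slot d →
    R.Holds c t t ω → R.Holds d t t ω → c = d
  /-- a counting process is finite at every time -/
  sent_finite : ∀ w t, {n : ℕ | R.sent w n ω ≤ ENNReal.ofReal t}.Finite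
  floods : ∀ w n, R.Floods w n ω
  peers_sub : ∀ t, 0 ≤ t → ∀ v ∈ R.peers t ω, v ∈ R.requested τ σ t ω ∧ v ∈ R.nodes t ω
  /-- Slots are permissionless and served first come, first served, and the agent repeats its
  requests without pause. If it has been requesting `v` during all of `[s, t]` and some
  dynamic slot of `v` was not blocked during all of `[s, t]` by one and the same
  connection, then the agent got hold of a slot and (taking it again at once whenever its own
  connection is torn down) still has it at time `t`. -/
  served : ∀ s t, 0 ≤ s → s ≤ t → ∀ v,
    (∀ r, s ≤ r → r ≤ t → v ∈ R.requested τ σ r ω ∧ v ∈ R.nodes r ω) →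
    (∃ i : Fin F, ¬ ∃ c, R.host c = v ∧ R.slot c = i ∧ R.Holds c s t ω) →
    v ∈ R.peers t ω

/-- `R` is a run of a quasi-live network in which the agent plays `σ` and the targets are the nodes
behind the logical IDs in `U`. -/
structure IsQuasiLive [MeasurableSpace Ω] (prm : Params) (R : Run V W C Ω prm.slots)
    (σ : Strategy V W prm.maxPeers) (U : Finset W) (P : Measure Ω) : Prop where
  nid_inj : Set.InjOn R.nid U
  dist_pos : ∀ u v, u ≠ v → 0 < R.dist u v
  dist_le : ∀ u v, u ≠ v → R.dist u v ≤ prm.wmax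
  triangle : ∀ u v z, R.dist u v ≤ R.dist u z + R.dist z v
  rules : ∀ᵐ ω ∂P, R.PathRules prm.tau σ U ω
  /-- Given the history `H n` up to query number `n` (which comprises the earlier answers and the
  set of present nodes), each present node is drawn with probability at least `q`. -/
  oracle_draw : ∃ H : ℕ → MeasurableSpace Ω,
    (∀ n, H n ≤ ‹MeasurableSpace Ω›) ∧
    (∀ n m v, m < n → MeasurableSet[H n] {ω | R.oracle m ω = v}) ∧
    (∀ n v, MeasurableSet {ω | R.oracle n ω = v}) ∧
    (∀ (n : ℕ) v, MeasurableSet[H n] {ω | v ∈ R.nodes ((n + 1) * prm.tau) ω}) ∧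
    ∀ (n : ℕ) v A, MeasurableSet[H n] A →
      ENNReal.ofReal prm.q * P (A ∩ {ω | v ∈ R.nodes ((n + 1) * prm.tau) ω}) ≤
        P (A ∩ {ω | R.oracle n ω = v})
  /-- dynamic connections last for an `Exp(lam)` time, whenever they were established -/
  start_meas : ∀ c, Measurable (R.start c)
  dur_meas : ∀ c, Measurable (R.dur c)
  dur_law : ∀ c, P.map (R.dur c) = expMeasure prm.lam
  dur_indep : ∀ c, IndepFun (R.start c) (R.dur c) P
  sent_meas : ∀ w n, Measurable (R.sent w n)
  /-- the activity condition on the targets -/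
  active : ∀ w ∈ U, ∀ t Δ : ℝ, 0 < t → 0 < Δ →
    P {ω | (R.count w (t + Δ) ω : ℝ) - R.count w t ω < prm.gam * Δ} <
      ENNReal.ofReal (prm.mu / Δ)

/-- At step `n` the agent names the correct network ID for every target. -/
def Found (R : Run V W C Ω F) (τ : ℝ) {k : ℕ} (σ : Strategy V W k) (U : Finset W)
    (n : ℕ) (ω : Ω) : Prop :=
  ∀ w ∈ U, σ.output (R.view τ n ω) w = some (R.nid w)

end Run

end PeerNet

/-!
A node other than the author of a message receives it strictly later than the author broadcasts it,
and the agent can compute when a peer received a message from the time of arrival and the link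
distance. So it compares the nodes in pairs: while it is connected to the target, every other node
delivers the target's messages with a later time of receipt, whence the target is beaten by no node
and beats every node against which one of its messages is compared.

A comparison may involve only messages broadcast after the target got connected; since a message
reaches a node within `card V` hops, it suffices to wait for `card V * wmax`. A target is lost only
if the oracle does not name it, if a slot stays occupied, or if the target is silent. The first two
probabilities decay exponentially, the last one like the reciprocal of the length of the
comparison, so that a length of order `|U| / ε` makes the union bound over the targets work.
-/

namespace PeerNet

variable {V W C Ω : Type*} {F : ℕ}

/-! ### Flooding -/

namespace Run

variable {R : Run V W C Ω F} {w : W} {n : ℕ} {v : V} {d : ℝ} {ω : Ω}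

namespace Floods

theorem exists_forwarder [Finite V] (h : R.Floods w n ω)
    (hpos : ∀ u v, u ≠ v → 0 < R.dist u v) (hv : v ≠ R.nid w) (hfin : R.recv w n v ω ≠ ⊤) :
    ∃ u, u ≠ v ∧ R.recv w n u ω < R.recv w n v ω ∧
      R.recv w n v ω = R.recv w n u ω + ENNReal.ofReal (R.dist (some u) (some v)) := by
  let forwarder := {u : V // R.recv w n u ω ≠ ⊤ ∧
    (R.graph (R.recv w n u ω).toReal ω).Adj u v}
  have hrecv : R.recv w n v ω =
      ⨅ u : forwarder, R.recv w n u ω + ENNReal.ofReal (R.dist (some u.1) (some v)) := by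
    rw [h.2 v hv, iInf_subtype']
  cases isEmpty_or_nonempty forwarder with
  | inl _ => exact absurd (hrecv.trans (iInf_of_empty _)) hfin
  | inr _ =>
    obtain ⟨⟨u, hu, hadj⟩, hmin⟩ := exists_eq_ciInf_of_finite (f := fun u : forwarder =>
      R.recv w n u ω + ENNReal.ofReal (R.dist (some u.1) (some v)))
    have hlink : R.recv w n v ω =
        R.recv w n u ω + ENNReal.ofReal (R.dist (some u) (some v)) := hrecv.trans hmin.symm
    have hdist : 0 < R.dist (some u) (some v) := hpos _ _ (by simpa using hadj.ne)
    refine ⟨u, hadj.ne, ?_, hlink⟩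
    rw [hlink]
    exact ENNReal.lt_add_right hu (ENNReal.ofReal_pos.2 hdist).ne'

@[elab_as_elim]
theorem recv_induction [Finite V] (h : R.Floods w n ω)
    (hpos : ∀ u v, u ≠ v → 0 < R.dist u v) {motive : V → Prop} (source : motive (R.nid w))
    (forward : ∀ u v, u ≠ v → R.recv w n u ω < R.recv w n v ω →
      R.recv w n v ω = R.recv w n u ω + ENNReal.ofReal (R.dist (some u) (some v)) →
      motive u → motive v)
    (v : V) (hfin : R.recv w n v ω ≠ ⊤) : motive v := by
  let : Preorder V := Preorder.lift fun u => R.recv w n u ω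
  induction v using (wellFounded_lt (α := V)).induction with
  | _ v ih =>
    obtain rfl | hv := eq_or_ne v (R.nid w)
    · exact source
    · obtain ⟨u, huv, hlt, hlink⟩ := h.exists_forwarder hpos hv hfin
      exact forward u v huv hlt hlink (ih u hlt hlt.ne_top)

theorem sent_le_recv [Finite V] (h : R.Floods w n ω)
    (hpos : ∀ u v, u ≠ v → 0 < R.dist u v) (v : V) : R.sent w n ω ≤ R.recv w n v ω := by
  by_cases hfin : R.recv w n v ω = ⊤
  · exact hfin ▸ le_top
  · refine h.recv_induction hpos ?_ (fun u v _ hlt _ ih => ?_) v hfin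
    · exact h.1.ge
    · exact ih.trans hlt.le

theorem sent_lt_recv [Finite V] (h : R.Floods w n ω)
    (hpos : ∀ u v, u ≠ v → 0 < R.dist u v) (hv : v ≠ R.nid w) (hfin : R.recv w n v ω ≠ ⊤) :
    R.sent w n ω < R.recv w n v ω := by
  obtain ⟨u, -, hlt, -⟩ := h.exists_forwarder hpos hv hfin
  exact (h.sent_le_recv hpos u).trans_lt hlt

theorem recv_le [Finite V] (h : R.Floods w n ω) (hpos : ∀ u v, u ≠ v → 0 < R.dist u v)
    (hle : ∀ u v, u ≠ v → R.dist u v ≤ d) (hfin : R.recv w n v ω ≠ ⊤) :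
    R.recv w n v ω ≤
      R.sent w n ω + {u | R.recv w n u ω < R.recv w n v ω}.ncard * ENNReal.ofReal d := by
  refine h.recv_induction hpos ?_ (fun u v huv hlt hlink ih => ?_) v hfin
  · exact h.1.trans_le le_self_add
  · have hearlier : {x | R.recv w n x ω < R.recv w n u ω}.ncard + 1 ≤
        {x | R.recv w n x ω < R.recv w n v ω}.ncard :=
      Set.ncard_lt_ncard (Set.ssubset_iff_exists.2
        ⟨fun x hx => lt_trans hx hlt, u, hlt, lt_irrefl (R.recv w n u ω)⟩)
    calc R.recv w n v ω
        ≤ (R.sent w n ω + {x | R.recv w n x ω < R.recv w n u ω}.ncard * ENNReal.ofReal d)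
            + ENNReal.ofReal d := by
          rw [hlink]
          gcongr
          exact hle _ _ (by simpa using huv)
      _ = R.sent w n ω + (({x | R.recv w n x ω < R.recv w n u ω}.ncard + 1 : ℕ) : ℝ≥0∞)
            * ENNReal.ofReal d := by push_cast; ring
      _ ≤ _ := by gcongr

theorem toReal_recv_le [Finite V] (h : R.Floods w n ω) (hpos : ∀ u v, u ≠ v → 0 < R.dist u v)
    (hle : ∀ u v, u ≠ v → R.dist u v ≤ d) (hd : 0 ≤ d) (hfin : R.recv w n v ω ≠ ⊤) :
    (R.recv w n v ω).toReal ≤ (R.sent w n ω).toReal + Nat.card V * d := by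
  have hs : R.sent w n ω ≠ ⊤ := ne_top_of_le_ne_top hfin (h.sent_le_recv hpos v)
  have hrecv : R.recv w n v ω ≤ R.sent w n ω + ENNReal.ofReal (Nat.card V * d) := by
    rw [ENNReal.ofReal_mul (by positivity), ENNReal.ofReal_natCast]
    refine (h.recv_le hpos hle hfin).trans ?_
    gcongr
    exact Set.ncard_le_card _
  have := ENNReal.toReal_mono (ENNReal.add_ne_top.2 ⟨hs, ENNReal.ofReal_ne_top⟩) hrecv
  rwa [ENNReal.toReal_add hs ENNReal.ofReal_ne_top, ENNReal.toReal_ofReal (by positivity)] at this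

end Floods

theorem exists_sent_of_count_lt {s t : ℝ}
    (hfin : {n : ℕ | R.sent w n ω ≤ ENNReal.ofReal s}.Finite) (hs : 0 ≤ s) (ht : 0 ≤ t)
    (h : R.count w s ω < R.count w t ω) :
    ∃ n, R.sent w n ω ≠ ⊤ ∧ (R.sent w n ω).toReal ∈ Set.Ioc s t := by
  obtain ⟨n, hn, hns⟩ : ∃ n, R.sent w n ω ≤ ENNReal.ofReal t ∧
      ¬ R.sent w n ω ≤ ENNReal.ofReal s :=
    Set.exists_mem_notMem_of_ncard_lt_ncard h hfin
  have htop : R.sent w n ω ≠ ⊤ := ne_top_of_le_ne_top ENNReal.ofReal_ne_top hn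
  exact ⟨n, htop, (ENNReal.ofReal_lt_iff_lt_toReal hs htop).1 (not_le.1 hns),
    ENNReal.toReal_le_of_le_ofReal ht hn⟩

end Run

/-! ### The comparison strategy -/

/-- The lengths of the phases of the comparison strategy. Step `n` is the time span between `n * τ`
and `(n + 1) * τ`, and every unordered pair of nodes has a block of steps of its own, during which
the agent requests the two. -/
structure Timetable where
  /-- number of initial steps in which the agent only queries the oracle -/
  naming : ℕ
  /-- number of steps in the block of a pair -/
  block : ℕ
  /-- time allowed at the start of a block for getting connected -/
  connect : ℝ
  /-- time allowed after that for the older messages to die out -/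
  spread : ℝ
  /-- length of the final part of a block, whose messages are compared -/
  watch : ℝ

namespace Timetable

variable (T : Timetable) (τ : ℝ)

/-- The step at which block number `i` starts. -/
def checkpoint (i : ℕ) : ℕ := T.naming + i * T.block

theorem monotone_checkpoint : Monotone T.checkpoint := fun _ _ hij => by
  unfold checkpoint; gcongr

variable (V) in
/-- The phases are long enough for networks on `V` with link distances at most `d`. -/
structure Fits (d : ℝ) : Prop where
  tau_pos : 0 < τ
  dist_nonneg : 0 ≤ d
  connect_pos : 0 < T.connect
  watch_pos : 0 < T.watch
  card_mul_le_spread : Nat.card V * d ≤ T.spread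
  lt_block : T.connect + T.spread + T.watch + d < T.block * τ

theorem Fits.spread_nonneg {T : Timetable} {τ d : ℝ} (hT : T.Fits V τ d) : 0 ≤ T.spread :=
  (mul_nonneg (Nat.cast_nonneg _) hT.dist_nonneg).trans hT.card_mul_le_spread

section Blocks

variable [Finite V]

/-- The first step of the block of `z`, for an arbitrary enumeration of the pairs. -/
noncomputable def startStep (z : Sym2 V) : ℕ := T.checkpoint (Finite.equivFin (Sym2 V) z)

/-- The first step after the block of `z`. -/
noncomputable def endStep (z : Sym2 V) : ℕ := T.checkpoint (Finite.equivFin (Sym2 V) z + 1)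

variable (V) in
/-- The first step after all blocks. -/
noncomputable def finish : ℕ := T.checkpoint (Nat.card (Sym2 V))

/-- The time at which the block of `z` starts. -/
noncomputable def startTime (z : Sym2 V) : ℝ := T.startStep z * τ

/-- The time from which on the messages of the block of `z` are compared. -/
noncomputable def openTime (z : Sym2 V) : ℝ := T.startTime τ z + T.connect + T.spread

/-- The time until which the messages of the block of `z` are compared. -/
noncomputable def closeTime (z : Sym2 V) : ℝ := T.openTime τ z + T.watch

theorem startTime_add_block (z : Sym2 V) : T.startTime τ z + T.block * τ = T.endStep z * τ := by
  simp only [startTime, startStep, endStep, checkpoint]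
  push_cast
  ring

theorem endStep_le_finish (z : Sym2 V) : T.endStep z ≤ T.finish V :=
  T.monotone_checkpoint (Finite.equivFin (Sym2 V) z).isLt

theorem eq_of_mem_Ico {z z' : Sym2 V} {n : ℕ} (hz : n ∈ Set.Ico (T.startStep z) (T.endStep z))
    (hz' : n ∈ Set.Ico (T.startStep z') (T.endStep z')) : z = z' := by
  by_contra hne
  exact Set.disjoint_left.1 (T.monotone_checkpoint.pairwise_disjoint_on_Ico_succ
    (Fin.val_injective.ne ((Finite.equivFin (Sym2 V)).injective.ne hne))) hz hz'

/-- The strategy's requests: the known nodes of the pair whose block comprises the present step.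
The number of answers is the number of the present step. -/
noncomputable def request (I : View V W) : Finset V :=
  (Set.toFinite {v | v ∈ I.answers ∧
    ∃ z : Sym2 V, v ∈ z ∧ I.answers.length ∈ Set.Ico (T.startStep z) (T.endStep z)}).toFinset

theorem mem_request {I : View V W} {v : V} : v ∈ T.request I ↔ v ∈ I.answers ∧
    ∃ z : Sym2 V, v ∈ z ∧ I.answers.length ∈ Set.Ico (T.startStep z) (T.endStep z) :=
  Set.Finite.mem_toFinset _

theorem card_request_le_two (I : View V W) : (T.request I).card ≤ 2 := by
  classical
  by_cases h : ∃ z : Sym2 V, I.answers.length ∈ Set.Ico (T.startStep z) (T.endStep z)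
  · obtain ⟨⟨u, v⟩, hz⟩ := h
    refine (Finset.card_le_card (t := {u, v}) fun x hx => ?_).trans Finset.card_le_two
    obtain ⟨-, z', hx, hz'⟩ := T.mem_request.1 hx
    obtain rfl := T.eq_of_mem_Ico hz hz'
    simpa using hx
  · have : T.request I = ∅ := Finset.eq_empty_of_forall_notMem fun v hv =>
      let ⟨_, z, _, hz⟩ := T.mem_request.1 hv
      h ⟨z, hz⟩
    simp [this]

end Blocks

end Timetable

/-- The time at which the delivering peer first received the message, which the agent computes from
the link distance. -/
def Arrival.receipt (a : Arrival V W) : ℝ := a.time - a.link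

namespace Timetable

variable [Finite V] (T : Timetable) (τ : ℝ)

/-- In the comparison of `u` and `v`, node `u` delivered a message of `x` which `v` did not deliver
with an earlier time of receipt. -/
def Beats (I : View V W) (x : W) (u v : V) : Prop :=
  ∃ a ∈ I.arrivals, a.sender = x ∧ a.peer = u ∧
    a.receipt ∈ Set.Icc (T.openTime τ s(u, v)) (T.closeTime τ s(u, v)) ∧
    ∀ b ∈ I.arrivals, b.sender = x → b.msg = a.msg → b.peer = v → a.receipt ≤ b.receipt

open Classical in
/-- The comparison strategy: compare all pairs of nodes in turn, and name a node that no other one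
has beaten. -/
noncomputable def strategy {k : ℕ} (hk : 2 ≤ k) : Strategy V W k where
  request := T.request
  output I x := if h : ∃ u, ∀ v, v ≠ u → ¬ T.Beats τ I x v u then some h.choose else none
  request_known _ _ hv := (T.mem_request.1 hv).1
  request_card I := (T.card_request_le_two I).trans hk

theorem output_strategy_eq_some {k : ℕ} (hk : 2 ≤ k) {I : View V W} {x : W} {u : V}
    (hunbeaten : ∀ v, v ≠ u → ¬ T.Beats τ I x v u) (hbeats : ∀ v, v ≠ u → T.Beats τ I x u v) :
    (T.strategy τ hk).output I x = some u := by
  have hex : ∃ u, ∀ v, v ≠ u → ¬ T.Beats τ I x v u := ⟨u, hunbeaten⟩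
  have hchoose : hex.choose = u := by
    by_contra hne
    exact hex.choose_spec u (Ne.symm hne) (hbeats _ hne)
  exact (dif_pos hex).trans (congrArg some hchoose)

variable {T τ} {d : ℝ}

theorem Fits.startTime_nonneg (hT : T.Fits V τ d) (z : Sym2 V) : 0 ≤ T.startTime τ z :=
  mul_nonneg (Nat.cast_nonneg _) hT.tau_pos.le

theorem Fits.openTime_pos (hT : T.Fits V τ d) (z : Sym2 V) : 0 < T.openTime τ z :=
  add_pos_of_pos_of_nonneg (add_pos_of_nonneg_of_pos (hT.startTime_nonneg z) hT.connect_pos)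
    hT.spread_nonneg

theorem Fits.closeTime_add_lt_endStep (hT : T.Fits V τ d) (z : Sym2 V) :
    T.closeTime τ z + d < T.endStep z * τ := by
  rw [← startTime_add_block, closeTime, openTime]
  linarith [hT.lt_block]

theorem Fits.endStep_mul_le_finish (hT : T.Fits V τ d) (z : Sym2 V) :
    T.endStep z * τ ≤ T.finish V * τ :=
  mul_le_mul_of_nonneg_right (by exact_mod_cast T.endStep_le_finish z) hT.tau_pos.le

end Timetable

namespace Run

variable {R : Run V W C Ω F} {τ : ℝ} {ω : Ω}

theorem Holds.mono {c : C} {s t t' : ℝ} (h : R.Holds c s t ω) (ht : t' ≤ t) : R.Holds c s t' ω :=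
  ⟨h.1, (ENNReal.ofReal_le_ofReal ht).trans_lt h.2⟩

theorem Delivers.receipt_eq {a : Arrival V W} (h : R.Delivers ω a) :
    a.receipt = (R.recv a.sender a.msg a.peer ω).toReal := by
  rw [Arrival.receipt, h.2.2.2, add_sub_cancel_right]

/-- One and the same connection occupies slot `i` of `v` during the whole of `[s, t]`. -/
def Blocked (R : Run V W C Ω F) (v : V) (i : Fin F) (s t : ℝ) (ω : Ω) : Prop :=
  ∃ c, R.host c = v ∧ R.slot c = i ∧ R.Holds c s t ω

/-- The arrival of message `n` of `x` at the agent when `nid x` itself delivers it. -/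
noncomputable def directArrival (R : Run V W C Ω F) (x : W) (n : ℕ) (ω : Ω) : Arrival V W where
  sender := x
  msg := n
  peer := R.nid x
  time := (R.sent x n ω).toReal + R.dist (some (R.nid x)) none
  link := R.dist (some (R.nid x)) none

theorem receipt_directArrival (R : Run V W C Ω F) (x : W) (n : ℕ) (ω : Ω) :
    (R.directArrival x n ω).receipt = (R.sent x n ω).toReal :=
  add_sub_cancel_right _ _

variable [Finite V] {T : Timetable} {U : Finset W} {k : ℕ} {hk : 2 ≤ k}

theorem mem_requested_strategy {u : V} {z : Sym2 V} {t : ℝ} (hτ : 0 < τ)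
    (hnamed : ∃ j < T.naming, R.oracle j ω = u) (hu : u ∈ z)
    (ht : t ∈ Set.Ico (T.startTime τ z) (T.endStep z * τ)) :
    u ∈ R.requested τ (T.strategy τ hk) t ω := by
  have ht0 : 0 ≤ t := (mul_nonneg (Nat.cast_nonneg _) hτ.le).trans ht.1
  have hstart : T.startStep z ≤ ⌊t / τ⌋₊ := Nat.le_floor ((le_div_iff₀ hτ).2 ht.1)
  have hend : ⌊t / τ⌋₊ < T.endStep z :=
    (Nat.floor_lt (div_nonneg ht0 hτ.le)).2 ((div_lt_iff₀ hτ).2 ht.2)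
  refine T.mem_request.2 ⟨?_, z, hu, ?_⟩
  · obtain ⟨j, hj, rfl⟩ := hnamed
    have hj' : j < ⌊t / τ⌋₊ := hj.trans_le ((Nat.le_add_right _ _).trans hstart)
    exact List.mem_map_of_mem (List.mem_range.2 hj')
  · simpa [view] using And.intro hstart hend

/-- The target behind `x` plays its part in the comparison strategy: the oracle names it in time,
and in each of its comparisons its slot `i` can be had in time and it broadcasts a message. -/
structure Exposed (R : Run V W C Ω F) (T : Timetable) (τ : ℝ) (x : W) (i : Fin F) (ω : Ω) :
    Prop where
  named : ∃ j < T.naming, R.oracle j ω = R.nid x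
  unblocked : ∀ v, ¬ R.Blocked (R.nid x) i (T.startTime τ s(R.nid x, v))
    (T.startTime τ s(R.nid x, v) + T.connect) ω
  active : ∀ v, R.count x (T.openTime τ s(R.nid x, v)) ω <
    R.count x (T.closeTime τ s(R.nid x, v)) ω

namespace Exposed

variable {x : W} {i : Fin F} {d : ℝ} {v : V}

theorem mem_peers (hx : R.Exposed T τ x i ω) (h : R.PathRules τ (T.strategy τ hk) U ω)
    (hT : T.Fits V τ d) (hxU : x ∈ U) {t : ℝ}
    (ht : t ∈ Set.Ico (T.startTime τ s(R.nid x, v) + T.connect) (T.endStep s(R.nid x, v) * τ)) :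
    R.nid x ∈ R.peers t ω := by
  have hstart := hT.startTime_nonneg s(R.nid x, v)
  refine h.served _ t hstart (by linarith [ht.1, hT.connect_pos]) _ (fun r hr hrt => ⟨?_, ?_⟩)
    ⟨i, ?_⟩
  · exact mem_requested_strategy hT.tau_pos hx.named (Sym2.mem_mk_left _ _)
      ⟨hr, hrt.trans_lt ht.2⟩
  · exact h.target_mem x hxU r (hstart.trans hr)
  · rintro ⟨c, hhost, hslot, hold⟩
    exact hx.unblocked v ⟨c, hhost, hslot, hold.mono ht.1⟩

theorem directArrival_mem (hx : R.Exposed T τ x i ω) (h : R.PathRules τ (T.strategy τ hk) U ω)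
    (hT : T.Fits V τ d) (hle : ∀ u v, u ≠ v → R.dist u v ≤ d) (hxU : x ∈ U) {n : ℕ}
    (hsent : R.sent x n ω ≠ ⊤)
    (ht : (R.sent x n ω).toReal ∈
      Set.Icc (T.startTime τ s(R.nid x, v) + T.connect) (T.closeTime τ s(R.nid x, v))) :
    R.directArrival x n ω ∈ (R.view τ (T.finish V) ω).arrivals := by
  have hrecv : R.recv x n (R.nid x) ω = R.sent x n ω := (h.floods x n).1
  have hend := hT.closeTime_add_lt_endStep s(R.nid x, v)
  have hpeer : R.nid x ∈ R.peers (R.sent x n ω).toReal ω :=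
    hx.mem_peers h hT hxU ⟨ht.1, by linarith [ht.2, hT.dist_nonneg]⟩
  refine ⟨⟨hrecv.symm ▸ hsent, hrecv.symm ▸ hpeer, rfl, ?_⟩, ?_⟩
  · simp only [directArrival, hrecv]
  · calc (R.sent x n ω).toReal + R.dist (some (R.nid x)) none
        ≤ T.closeTime τ s(R.nid x, v) + d := add_le_add ht.2 (hle _ _ (by simp))
      _ < T.finish V * τ := hend.trans_le (hT.endStep_mul_le_finish _)

theorem not_beats (hx : R.Exposed T τ x i ω) (h : R.PathRules τ (T.strategy τ hk) U ω)
    (hT : T.Fits V τ d) (hpos : ∀ u v, u ≠ v → 0 < R.dist u v)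
    (hle : ∀ u v, u ≠ v → R.dist u v ≤ d) (hxU : x ∈ U) (hv : v ≠ R.nid x) :
    ¬ T.Beats τ (R.view τ (T.finish V) ω) x v (R.nid x) := by
  rintro ⟨a, ⟨ha, -⟩, rfl, rfl, hwindow, hfirst⟩
  have hflood := h.floods a.sender a.msg
  have hlt := hflood.sent_lt_recv hpos hv ha.1
  have hlate : (R.sent a.sender a.msg ω).toReal < a.receipt :=
    ha.receipt_eq ▸ ENNReal.toReal_strict_mono ha.1 hlt
  have hspread : a.receipt ≤ (R.sent a.sender a.msg ω).toReal + T.spread := by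
    linarith [ha.receipt_eq, hflood.toReal_recv_le hpos hle hT.dist_nonneg ha.1,
      hT.card_mul_le_spread]
  rw [Sym2.eq_swap] at hwindow
  have hopen : T.startTime τ s(R.nid a.sender, a.peer) + T.connect + T.spread ≤ a.receipt :=
    hwindow.1
  have hdirect := hx.directArrival_mem h hT hle hxU hlt.ne_top
    ⟨by linarith, hlate.le.trans hwindow.2⟩
  exact (hfirst _ hdirect rfl rfl rfl).not_gt ((receipt_directArrival ..).trans_lt hlate)

theorem beats (hx : R.Exposed T τ x i ω) (h : R.PathRules τ (T.strategy τ hk) U ω)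
    (hT : T.Fits V τ d) (hpos : ∀ u v, u ≠ v → 0 < R.dist u v)
    (hle : ∀ u v, u ≠ v → R.dist u v ≤ d) (hxU : x ∈ U) (hv : v ≠ R.nid x) :
    T.Beats τ (R.view τ (T.finish V) ω) x (R.nid x) v := by
  have hopen := (hT.openTime_pos s(R.nid x, v)).le
  obtain ⟨n, hsent, hn⟩ := exists_sent_of_count_lt (h.sent_finite x _) hopen
    (add_nonneg hopen hT.watch_pos.le) (hx.active v)
  have hdirect := hx.directArrival_mem h hT hle hxU hsent
    ⟨(le_add_of_nonneg_right hT.spread_nonneg).trans hn.1.le, hn.2⟩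
  refine ⟨_, hdirect, rfl, rfl, ?_, ?_⟩
  · rw [receipt_directArrival]
    exact Set.Ioc_subset_Icc_self hn
  · rintro b ⟨hb, -⟩ rfl hmsg rfl
    obtain rfl : b.msg = n := hmsg
    rw [receipt_directArrival, hb.receipt_eq]
    exact ENNReal.toReal_mono hb.1 ((h.floods _ _).sent_le_recv hpos _)

theorem output_eq_some_nid (hx : R.Exposed T τ x i ω)
    (h : R.PathRules τ (T.strategy τ hk) U ω) (hT : T.Fits V τ d)
    (hpos : ∀ u v, u ≠ v → 0 < R.dist u v) (hle : ∀ u v, u ≠ v → R.dist u v ≤ d) (hxU : x ∈ U) :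
    (T.strategy τ hk).output (R.view τ (T.finish V) ω) x = some (R.nid x) :=
  T.output_strategy_eq_some τ hk (fun _ => hx.not_beats h hT hpos hle hxU)
    (fun _ => hx.beats h hT hpos hle hxU)

end Exposed

end Run

/-! ### Probability estimates -/

theorem expMeasure_Ioi {r x : ℝ} (hr : 0 < r) (hx : 0 ≤ x) :
    expMeasure r (Set.Ioi x) = ENNReal.ofReal (Real.exp (-(r * x))) := by
  have := isProbabilityMeasure_expMeasure hr
  rw [← Set.compl_Iic, ← ofReal_measureReal, probReal_compl_eq_one_sub measurableSet_Iic,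
    ← cdf_eq_real, cdf_expMeasure_eq hr, if_pos hx, sub_sub_cancel]

theorem expMeasure_Ioi_add {r x y : ℝ} (hr : 0 < r) (hx : 0 ≤ x) (hy : 0 ≤ y) :
    expMeasure r (Set.Ioi (x + y)) =
      ENNReal.ofReal (Real.exp (-(r * y))) * expMeasure r (Set.Ioi x) := by
  rw [expMeasure_Ioi hr hx, expMeasure_Ioi hr (add_nonneg hx hy),
    ← ENNReal.ofReal_mul (Real.exp_nonneg _), ← Real.exp_add]
  ring_nf

theorem ofReal_lt_add_ofReal_iff {a : ℝ≥0∞} {t y : ℝ} (ht : 0 ≤ t) (ha : a ≤ ENNReal.ofReal t) :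
    ENNReal.ofReal t < a + ENNReal.ofReal y ↔ t - a.toReal < y := by
  lift a to NNReal using ne_top_of_le_ne_top ENNReal.ofReal_ne_top ha
  have ha' : (a : ℝ) ≤ t := ENNReal.toReal_le_of_le_ofReal ht ha
  obtain hy | hy := le_total 0 y
  · rw [ENNReal.coe_toReal, ← ENNReal.ofReal_coe_nnreal, ← ENNReal.ofReal_add a.coe_nonneg hy,
      ENNReal.ofReal_lt_ofReal_iff_of_nonneg ht, sub_lt_iff_lt_add']
  · rw [ENNReal.ofReal_of_nonpos hy, add_zero, ENNReal.coe_toReal]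
    exact ⟨fun h => absurd h ha.not_gt, fun h => by linarith⟩

section Measure

variable [MeasurableSpace Ω] {P : Measure Ω}

theorem measure_prodMk_mem_of_indepFun [IsFiniteMeasure P] {A B : Type*} [MeasurableSpace A]
    [MeasurableSpace B] {X : Ω → A} {Y : Ω → B} (hX : Measurable X) (hY : Measurable Y)
    (hXY : IndepFun X Y P) {S : Set (A × B)} (hS : MeasurableSet S) :
    P {ω | (X ω, Y ω) ∈ S} = ∫⁻ a, P.map Y (Prod.mk a ⁻¹' S) ∂P.map X := by
  rw [← Measure.prod_apply hS,
    ← (indepFun_iff_map_prod_eq_prod_map_map hX.aemeasurable hY.aemeasurable).1 hXY,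
    Measure.map_apply (hX.prodMk hY) hS]
  rfl

theorem measure_exp_lifetime_covers_add [IsFiniteMeasure P] {X : Ω → ℝ≥0∞} {Y : Ω → ℝ}
    (hX : Measurable X) (hY : Measurable Y) {r : ℝ} (hr : 0 < r) (hlaw : P.map Y = expMeasure r)
    (hXY : IndepFun X Y P) {s l : ℝ} (hs : 0 ≤ s) (hl : 0 ≤ l) :
    P {ω | X ω ≤ ENNReal.ofReal s ∧ ENNReal.ofReal (s + l) < X ω + ENNReal.ofReal (Y ω)} =
      ENNReal.ofReal (Real.exp (-(r * l))) *
        P {ω | X ω ≤ ENNReal.ofReal s ∧ ENNReal.ofReal s < X ω + ENNReal.ofReal (Y ω)} := by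
  let S (t : ℝ) : Set (ℝ≥0∞ × ℝ) :=
    {z | z.1 ≤ ENNReal.ofReal s ∧ ENNReal.ofReal t < z.1 + ENNReal.ofReal z.2}
  have hS (t : ℝ) : MeasurableSet (S t) :=
    (measurableSet_le measurable_fst measurable_const).inter
      (measurableSet_lt measurable_const (measurable_fst.add measurable_snd.ennreal_ofReal))
  have hsection {a : ℝ≥0∞} (ha : a ≤ ENNReal.ofReal s) {t : ℝ} (ht : s ≤ t) :
      Prod.mk a ⁻¹' S t = Set.Ioi (t - a.toReal) := by
    ext y
    simp only [S, Set.mem_preimage, Set.mem_ofPred_eq, ha, true_and, Set.mem_Ioi,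
      ofReal_lt_add_ofReal_iff (hs.trans ht) (ha.trans (ENNReal.ofReal_le_ofReal ht))]
  have hdisintegrate (t : ℝ) : P {ω | X ω ≤ ENNReal.ofReal s ∧
      ENNReal.ofReal t < X ω + ENNReal.ofReal (Y ω)} =
      ∫⁻ a, expMeasure r (Prod.mk a ⁻¹' S t) ∂P.map X :=
    hlaw ▸ measure_prodMk_mem_of_indepFun hX hY hXY (hS t)
  rw [hdisintegrate, hdisintegrate, ← lintegral_const_mul' _ _ ENNReal.ofReal_ne_top]
  refine lintegral_congr fun a => ?_
  by_cases ha : a ≤ ENNReal.ofReal s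
  · have ha' : 0 ≤ s - a.toReal := sub_nonneg.2 (ENNReal.toReal_le_of_le_ofReal hs ha)
    rw [hsection ha (le_add_of_nonneg_right hl), hsection ha le_rfl, add_sub_right_comm,
      expMeasure_Ioi_add hr ha' hl]
  · have hempty (t : ℝ) : Prod.mk a ⁻¹' S t = ∅ := Set.eq_empty_of_forall_notMem fun _ hy => ha hy.1
    simp only [hempty, measure_empty, mul_zero]

theorem measureReal_forall_lt_notMem_le_exp [IsProbabilityMeasure P] {E : ℕ → Set Ω} {q : ℝ}
    (hE : ∀ n, MeasurableSet (E n))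
    (hq : ∀ n, q * P.real {ω | ∀ i < n, ω ∉ E i} ≤ P.real ({ω | ∀ i < n, ω ∉ E i} ∩ E n))
    (n : ℕ) : P.real {ω | ∀ i < n, ω ∉ E i} ≤ Real.exp (-(q * n)) := by
  induction n with
  | zero => simp
  | succ n ih =>
    have hsucc : {ω | ∀ i < n + 1, ω ∉ E i} = {ω | ∀ i < n, ω ∉ E i} \ E n := by
      ext ω
      exact Nat.forall_lt_succ_right
    have hsplit := measureReal_inter_add_sdiff (μ := P) (s := {ω | ∀ i < n, ω ∉ E i}) (hE n)
    calc P.real {ω | ∀ i < n + 1, ω ∉ E i}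
        ≤ (-q + 1) * P.real {ω | ∀ i < n, ω ∉ E i} := by rw [hsucc]; linarith [hq n]
      _ ≤ Real.exp (-q) * Real.exp (-(q * n)) := by
          gcongr
          exact Real.add_one_le_exp _
      _ = Real.exp (-(q * (n + 1 : ℕ))) := by
          rw [← Real.exp_add]
          push_cast
          ring_nf

end Measure

namespace Run.IsQuasiLive

variable [MeasurableSpace Ω] {prm : Params} {R : Run V W C Ω prm.slots}
  {σ : Strategy V W prm.maxPeers} {U : Finset W} {P : Measure Ω} {x : W} {T : Timetable}

theorem measureReal_silent_le (h : R.IsQuasiLive prm σ U P) (hx : x ∈ U) {t Δ : ℝ}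
    (ht : 0 < t) (hΔ : 0 < Δ) :
    P.real {ω | R.count x (t + Δ) ω ≤ R.count x t ω} ≤ prm.mu / Δ := by
  refine ENNReal.toReal_le_of_le_ofReal (div_nonneg prm.mu_pos.le hΔ.le)
    ((measure_mono fun ω hω => ?_).trans (h.active x hx t Δ ht hΔ).le)
  have hcount : (R.count x (t + Δ) ω : ℝ) ≤ R.count x t ω := Nat.cast_le.2 hω
  exact (sub_nonpos.2 hcount).trans_lt (mul_pos prm.gam_pos hΔ)

variable [IsProbabilityMeasure P]

theorem tsum_measure_holds_le_one [Countable C] (h : R.IsQuasiLive prm σ U P) (v : V)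
    (i : Fin prm.slots) {s : ℝ} (hs : 0 ≤ s) :
    ∑' c : {c // R.host c = v ∧ R.slot c = i}, P {ω | R.Holds c s s ω} ≤ 1 := by
  have hmeas (c : C) : MeasurableSet {ω | R.Holds c s s ω} :=
    (measurableSet_le (h.start_meas c) measurable_const).inter
      (measurableSet_lt measurable_const ((h.start_meas c).add (h.dur_meas c).ennreal_ofReal))
  have hdisj : Pairwise (Function.onFun (AEDisjoint P)
      fun c : {c // R.host c = v ∧ R.slot c = i} => {ω | R.Holds c s s ω}) := by
    refine fun c c' hne => measure_mono_null (fun ω hω => ?_) (ae_iff.1 h.rules)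
    exact fun hrules => hne (Subtype.ext (hrules.slot_excl c c' s hs
      (c.2.1.trans c'.2.1.symm) (c.2.2.trans c'.2.2.symm) hω.1 hω.2))
  rw [← measure_iUnion₀ hdisj fun c => (hmeas c).nullMeasurableSet]
  exact prob_le_one

theorem measureReal_blocked_le [Countable C] (h : R.IsQuasiLive prm σ U P) (v : V)
    (i : Fin prm.slots) {s l : ℝ} (hs : 0 ≤ s) (hl : 0 ≤ l) :
    P.real {ω | R.Blocked v i s (s + l) ω} ≤ Real.exp (-(prm.lam * l)) := by
  refine ENNReal.toReal_le_of_le_ofReal (Real.exp_nonneg _) ?_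
  calc P {ω | R.Blocked v i s (s + l) ω}
      ≤ P (⋃ c : {c // R.host c = v ∧ R.slot c = i}, {ω | R.Holds c s (s + l) ω}) :=
        measure_mono fun _ ⟨c, hhost, hslot, hold⟩ => Set.mem_iUnion.2 ⟨⟨c, hhost, hslot⟩, hold⟩
    _ ≤ ∑' c : {c // R.host c = v ∧ R.slot c = i}, P {ω | R.Holds c s (s + l) ω} :=
        measure_iUnion_le _
    _ = ENNReal.ofReal (Real.exp (-(prm.lam * l))) *
          ∑' c : {c // R.host c = v ∧ R.slot c = i}, P {ω | R.Holds c s s ω} := by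
        rw [← ENNReal.tsum_mul_left]
        exact tsum_congr fun c => measure_exp_lifetime_covers_add (h.start_meas c) (h.dur_meas c)
          prm.lam_pos (h.dur_law c) (h.dur_indep c) hs hl
    _ ≤ ENNReal.ofReal (Real.exp (-(prm.lam * l))) :=
        mul_le_of_le_one_right' (h.tsum_measure_holds_le_one v i hs)

theorem measureReal_not_named_le (h : R.IsQuasiLive prm σ U P) (hx : x ∈ U) (n : ℕ) :
    P.real {ω | ∀ i < n, R.oracle i ω ≠ R.nid x} ≤ Real.exp (-(prm.q * n)) := by
  obtain ⟨H, -, hpast, hmeas, -, hdraw⟩ := h.oracle_draw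
  refine measureReal_forall_lt_notMem_le_exp (fun n => hmeas n (R.nid x)) (fun n => ?_) n
  set A : Set Ω := {ω | ∀ i < n, ω ∉ {ω | R.oracle i ω = R.nid x}}
  have hA : MeasurableSet[H n] A := by
    have : A = ⋂ i, ⋂ (_ : i < n), {ω | R.oracle i ω = R.nid x}ᶜ := by ext; simp [A]
    rw [this]
    exact MeasurableSet.iInter fun i => MeasurableSet.iInter fun hi => (hpast n i _ hi).compl
  have hpresent : P.real (A ∩ {ω | R.nid x ∈ R.nodes ((n + 1) * prm.tau) ω}) = P.real A := by
    refine measureReal_congr ?_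
    filter_upwards [h.rules] with ω hω
    exact propext (and_iff_left (hω.target_mem x hx _ (by have := prm.tau_pos; positivity)))
  have hstep := ENNReal.toReal_mono (measure_ne_top P _) (hdraw n (R.nid x) A hA)
  rw [ENNReal.toReal_mul, ENNReal.toReal_ofReal prm.q_pos.le] at hstep
  exact hpresent ▸ hstep

theorem measureReal_not_exposed_le [Finite V] [Countable C] (h : R.IsQuasiLive prm σ U P)
    (hT : T.Fits V prm.tau prm.wmax) (hx : x ∈ U) (i : Fin prm.slots) :
    P.real {ω | ¬ R.Exposed T prm.tau x i ω} ≤ Real.exp (-(prm.q * T.naming)) +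
      Nat.card V * (Real.exp (-(prm.lam * T.connect)) + prm.mu / T.watch) := by
  have := Fintype.ofFinite V
  let unnamed : Set Ω := {ω | ∀ j < T.naming, R.oracle j ω ≠ R.nid x}
  let blocked (v : V) : Set Ω := {ω | R.Blocked (R.nid x) i (T.startTime prm.tau s(R.nid x, v))
    (T.startTime prm.tau s(R.nid x, v) + T.connect) ω}
  let silent (v : V) : Set Ω := {ω | R.count x (T.closeTime prm.tau s(R.nid x, v)) ω ≤
    R.count x (T.openTime prm.tau s(R.nid x, v)) ω}
  have hcover : {ω | ¬ R.Exposed T prm.tau x i ω} ⊆ unnamed ∪ ⋃ v, (blocked v ∪ silent v) := by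
    intro ω hω
    by_contra hno
    simp only [unnamed, blocked, silent, Set.mem_union, Set.mem_iUnion, Set.mem_ofPred_eq,
      not_or, not_exists, not_forall, not_not, not_le, exists_prop] at hno
    exact hω ⟨hno.1, fun v => (hno.2 v).1, fun v => (hno.2 v).2⟩
  have hpair (v : V) : P.real (blocked v ∪ silent v) ≤
      Real.exp (-(prm.lam * T.connect)) + prm.mu / T.watch :=
    (measureReal_union_le _ _).trans (add_le_add
      (h.measureReal_blocked_le _ i (hT.startTime_nonneg _) hT.connect_pos.le)
      (h.measureReal_silent_le hx (hT.openTime_pos _) hT.watch_pos))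
  calc P.real {ω | ¬ R.Exposed T prm.tau x i ω}
      ≤ P.real unnamed + ∑ v, P.real (blocked v ∪ silent v) :=
        (measureReal_mono hcover).trans ((measureReal_union_le _ _).trans
          (add_le_add_right (measureReal_iUnion_fintype_le _) _))
    _ ≤ _ := by
        gcongr
        · exact h.measureReal_not_named_le hx _
        · refine (Finset.sum_le_card_nsmul _ _ _ fun v _ => hpair v).trans_eq ?_
          rw [nsmul_eq_mul, Finset.card_univ, Nat.card_eq_fintype_card]

theorem measureReal_not_found_le [Finite V] [Countable C]
    (h : R.IsQuasiLive prm (T.strategy prm.tau prm.two_le_maxPeers) U P)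
    (hT : T.Fits V prm.tau prm.wmax) :
    P.real {ω | ¬ R.Found prm.tau (T.strategy prm.tau prm.two_le_maxPeers) U (T.finish V) ω} ≤
      U.card * (Real.exp (-(prm.q * T.naming)) +
        Nat.card V * (Real.exp (-(prm.lam * T.connect)) + prm.mu / T.watch)) := by
  let i : Fin prm.slots := ⟨0, prm.slots_pos⟩
  have hcover : {ω | ¬ R.Found prm.tau (T.strategy prm.tau prm.two_le_maxPeers) U
      (T.finish V) ω} ≤ᵐ[P] ⋃ x ∈ U, {ω | ¬ R.Exposed T prm.tau x i ω} := by
    filter_upwards [h.rules] with ω hω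
    refine not_imp_comm.1 fun hno x hx => ?_
    have hexposed : R.Exposed T prm.tau x i ω :=
      not_not.1 fun hx' => hno (Set.mem_iUnion₂.2 ⟨x, hx, hx'⟩)
    exact hexposed.output_eq_some_nid hω hT h.dist_pos h.dist_le hx
  calc _ ≤ P.real (⋃ x ∈ U, {ω | ¬ R.Exposed T prm.tau x i ω}) :=
        ENNReal.toReal_mono (measure_ne_top _ _) (measure_mono_ae hcover)
    _ ≤ ∑ x ∈ U, P.real {ω | ¬ R.Exposed T prm.tau x i ω} := measureReal_biUnion_finset_le _ _
    _ ≤ _ := by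
        rw [← nsmul_eq_mul]
        exact Finset.sum_le_card_nsmul _ _ _ fun x hx => h.measureReal_not_exposed_le hT hx i

end Run.IsQuasiLive

/-! ### The choice of the timetable -/

theorem card_sym2_le_sq [Finite V] : Nat.card (Sym2 V) ≤ Nat.card V ^ 2 := by
  rw [sq, ← Nat.card_prod]
  exact Nat.card_le_card_of_surjective _ Sym2.mk_surjective

namespace Params

variable (prm : Params)

/-- The timetable with which every target is missed with probability at most `1 / z`: not being
named, the blocked slots and the silent periods contribute at most `1 / (3 * z)` each. -/
noncomputable def timetable (z : ℝ) : Timetable where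
  naming := ⌈3 / prm.q * z⌉₊
  connect := 3 * prm.maxNodes / prm.lam * z
  spread := prm.maxNodes * prm.wmax
  watch := 3 * prm.maxNodes * prm.mu * z
  block := ⌊(3 * prm.maxNodes / prm.lam * z + prm.maxNodes * prm.wmax +
    3 * prm.maxNodes * prm.mu * z + prm.wmax) / prm.tau⌋₊ + 1

variable {z : ℝ}

theorem fits_timetable [Finite V] [Nonempty V] (hV : Nat.card V ≤ prm.maxNodes) (hz : 0 < z) :
    (prm.timetable z).Fits V prm.tau prm.wmax := by
  have hm : (0 : ℝ) < prm.maxNodes := Nat.cast_pos.2 (Nat.card_pos.trans_le hV)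
  have := prm.lam_pos
  have := prm.mu_pos
  exact
  { tau_pos := prm.tau_pos
    dist_nonneg := prm.wmax_pos.le
    connect_pos := by dsimp only [timetable]; positivity
    watch_pos := by dsimp only [timetable]; positivity
    card_mul_le_spread := mul_le_mul_of_nonneg_right (Nat.cast_le.2 hV) prm.wmax_pos.le
    lt_block := by
      rw [← div_lt_iff₀ prm.tau_pos]
      exact_mod_cast Nat.lt_floor_add_one _ }

theorem timetable_error_le (hm : 0 < prm.maxNodes) (hz : 0 < z) :
    Real.exp (-(prm.q * (prm.timetable z).naming)) + prm.maxNodes *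
      (Real.exp (-(prm.lam * (prm.timetable z).connect)) + prm.mu / (prm.timetable z).watch) ≤
        z⁻¹ := by
  have hm' : (0 : ℝ) < prm.maxNodes := Nat.cast_pos.2 hm
  have hq := prm.q_pos
  have hlam := prm.lam_pos
  have hmu := prm.mu_pos
  have hexp {x y : ℝ} (hx : 0 < x) (hxy : x ≤ y) : Real.exp (-y) ≤ x⁻¹ := by
    rw [Real.exp_neg]
    exact inv_anti₀ hx (by linarith [Real.add_one_le_exp y])
  have hnaming : 3 * z ≤ prm.q * (prm.timetable z).naming := by
    calc 3 * z = prm.q * (3 / prm.q * z) := by field_simp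
      _ ≤ _ := mul_le_mul_of_nonneg_left (Nat.le_ceil _) hq.le
  have hconnect : 3 * prm.maxNodes * z ≤ prm.lam * (prm.timetable z).connect := by
    dsimp only [timetable]
    field_simp
    rfl
  calc _ ≤ (3 * z)⁻¹ + prm.maxNodes *
        ((3 * prm.maxNodes * z)⁻¹ + prm.mu / (3 * prm.maxNodes * prm.mu * z)) := by
        gcongr
        · exact hexp (by positivity) hnaming
        · exact hexp (by positivity) hconnect
        · exact le_rfl
    _ = z⁻¹ := by
        field_simp
        norm_num

theorem block_mul_tau_le (hz : 0 < z) : (prm.timetable z).block * prm.tau ≤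
    (prm.timetable z).connect + (prm.timetable z).spread + (prm.timetable z).watch +
      prm.wmax + prm.tau := by
  have := prm.lam_pos
  have := prm.mu_pos
  have := prm.wmax_pos
  have hτ := prm.tau_pos
  rw [← sub_le_iff_le_add, ← sub_one_mul, ← le_div_iff₀ hτ, sub_le_iff_le_add]
  dsimp only [timetable]
  push_cast
  gcongr
  exact Nat.floor_le (by positivity)

theorem exists_finish_mul_le : ∃ K : ℝ, 0 < K ∧ ∀ (V : Type*) [Finite V],
    Nat.card V ≤ prm.maxNodes → ∀ z : ℝ, 1 ≤ z →
      (prm.timetable z).finish V * prm.tau ≤ K * z := by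
  have := prm.q_pos
  have := prm.lam_pos
  have := prm.mu_pos
  have := prm.wmax_pos
  have := prm.tau_pos
  let blockRate : ℝ := 3 * prm.maxNodes / prm.lam + prm.maxNodes * prm.wmax +
    3 * prm.maxNodes * prm.mu + prm.wmax + prm.tau
  refine ⟨(3 / prm.q + 1) * prm.tau + prm.maxNodes ^ 2 * blockRate, by positivity,
    fun V _ hV z hz => ?_⟩
  have hz₀ : 0 < z := zero_lt_one.trans_le hz
  have hnaming : ((prm.timetable z).naming : ℝ) ≤ (3 / prm.q + 1) * z := by
    rw [add_one_mul]
    exact (Nat.ceil_lt_add_one (by positivity)).le.trans (by gcongr)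
  have hblock : (prm.timetable z).block * prm.tau ≤ blockRate * z := by
    refine (prm.block_mul_tau_le hz₀).trans ?_
    have hspread : prm.maxNodes * prm.wmax ≤ prm.maxNodes * prm.wmax * z :=
      le_mul_of_one_le_right (by positivity) hz
    have hrest : prm.wmax + prm.tau ≤ (prm.wmax + prm.tau) * z :=
      le_mul_of_one_le_right (by positivity) hz
    dsimp only [blockRate, timetable]
    linarith
  calc (prm.timetable z).finish V * prm.tau
      = (prm.timetable z).naming * prm.tau +
          Nat.card (Sym2 V) * ((prm.timetable z).block * prm.tau) := by
        simp only [Timetable.finish, Timetable.checkpoint]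
        push_cast
        ring
    _ ≤ ((3 / prm.q + 1) * z) * prm.tau + prm.maxNodes ^ 2 * (blockRate * z) := by
        gcongr
        exact_mod_cast card_sym2_le_sq.trans (Nat.pow_le_pow_left hV 2)
    _ = _ := by ring

end Params

theorem Run.IsQuasiLive.measure_not_found_le [MeasurableSpace Ω] [Finite V] [Nonempty V]
    [Countable C] {prm : Params} {z : ℝ} {R : Run V W C Ω prm.slots} {U : Finset W}
    {P : Measure Ω} [IsProbabilityMeasure P] (hV : Nat.card V ≤ prm.maxNodes) (hz : 0 < z)
    (h : R.IsQuasiLive prm ((prm.timetable z).strategy prm.tau prm.two_le_maxPeers) U P) :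
    P {ω | ¬ R.Found prm.tau ((prm.timetable z).strategy prm.tau prm.two_le_maxPeers) U
      ((prm.timetable z).finish V) ω} ≤ ENNReal.ofReal (U.card * z⁻¹) := by
  have hmu := prm.mu_pos
  have hfits := prm.fits_timetable hV hz
  have hwatch := hfits.watch_pos
  rw [← ofReal_measureReal]
  refine ENNReal.ofReal_le_ofReal ((h.measureReal_not_found_le hfits).trans ?_)
  gcongr
  exact (by gcongr : _ ≤ _).trans (prm.timetable_error_le (Nat.card_pos.trans_le hV) hz)

theorem mul_inv_le_mul_sq_mul_inv_mul_log_sq {ε ε₀ : ℝ} (n : ℕ) (hε : 0 < ε) (hεε₀ : ε ≤ ε₀)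
    (hε₀ : ε₀ < 1) :
    n * ε⁻¹ ≤ (Real.log ε₀⁻¹ ^ 2)⁻¹ * ((n : ℝ) ^ 2 * ε⁻¹ * Real.log ε⁻¹ ^ 2) := by
  have hε₀' : 0 < ε₀ := hε.trans_le hεε₀
  have hlog₀ : 0 < Real.log ε₀⁻¹ := Real.log_pos ((one_lt_inv₀ hε₀').2 hε₀)
  have hlog : Real.log ε₀⁻¹ ≤ Real.log ε⁻¹ :=
    Real.log_le_log (inv_pos.2 hε₀') (inv_anti₀ hε hεε₀)
  have hn : (n : ℝ) ≤ (n : ℝ) ^ 2 := by exact_mod_cast Nat.le_self_pow two_ne_zero n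
  rw [le_inv_mul_iff₀ (by positivity), mul_comm]
  gcongr

end PeerNet

theorem mainTheorem2_general (prm : PeerNet.Params) :
    ∃ K : ℝ, 0 < K ∧
      ∀ (V W : Type*) [Fintype V], Fintype.card V ≤ prm.maxNodes →
      ∀ (U : Finset W) (ε : ℝ), 0 < ε → ε ≤ 1 →
      ∃ (σ : PeerNet.Strategy V W prm.maxPeers) (N : ℕ),
        N * prm.tau ≤ K * (U.card * ε⁻¹) ∧
        ∀ (C Ω : Type*) [Countable C] [MeasurableSpace Ω] (P : Measure Ω)
          [IsProbabilityMeasure P] (R : PeerNet.Run V W C Ω prm.slots),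
          R.IsQuasiLive prm σ U P →
          P {ω | ¬ R.Found prm.tau σ U N ω} ≤ ENNReal.ofReal ε := by
  obtain ⟨K, hK, hfinish⟩ := prm.exists_finish_mul_le
  refine ⟨K, hK, fun V W _ hV U ε hε hε₁ => ?_⟩
  rw [← Nat.card_eq_fintype_card] at hV
  obtain rfl | ⟨x, hx⟩ := U.eq_empty_or_nonempty
  · refine ⟨⟨fun _ => ∅, fun _ _ => none, by simp, by simp⟩, 0, by simp, ?_⟩
    intros
    simp [PeerNet.Run.Found]
  have hU : (1 : ℝ) ≤ U.card := Nat.one_le_cast.2 (Finset.card_pos.2 ⟨x, hx⟩)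
  have hz : 1 ≤ U.card * ε⁻¹ := one_le_mul_of_one_le_of_one_le hU ((one_le_inv₀ hε).2 hε₁)
  refine ⟨(prm.timetable (U.card * ε⁻¹)).strategy prm.tau prm.two_le_maxPeers,
    (prm.timetable (U.card * ε⁻¹)).finish V, hfinish V hV _ hz, ?_⟩
  intro C Ω _ _ P _ R hR
  have : Nonempty V := ⟨R.nid x⟩
  convert hR.measure_not_found_le hV (zero_lt_one.trans_le hz) using 2
  field_simp

theorem mainTheorem2 (prm : PeerNet.Params) (ε₀ : ℝ) (hε₀ : 0 < ε₀) (hε₀' : ε₀ < 1) :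
    ∃ K : ℝ, 0 < K ∧
      ∀ (V W : Type*) [Fintype V], Fintype.card V ≤ prm.maxNodes →
      ∀ (U : Finset W) (ε : ℝ), 0 < ε → ε ≤ ε₀ →
      ∃ (σ : PeerNet.Strategy V W prm.maxPeers) (N : ℕ),
        N * prm.tau ≤ K * ((U.card : ℝ) ^ 2 * ε⁻¹ * Real.log ε⁻¹ ^ 2) ∧
        ∀ (C Ω : Type*) [Countable C] [MeasurableSpace Ω] (P : Measure Ω)
          [IsProbabilityMeasure P] (R : PeerNet.Run V W C Ω prm.slots),
          R.IsQuasiLive prm σ U P →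
          P {ω | ¬ R.Found prm.tau σ U N ω} ≤ ENNReal.ofReal ε := by
  obtain ⟨K, hK, hgeneral⟩ := mainTheorem2_general prm
  have hlog : 0 < Real.log ε₀⁻¹ := Real.log_pos ((one_lt_inv₀ hε₀).2 hε₀')
  refine ⟨K * (Real.log ε₀⁻¹ ^ 2)⁻¹, by positivity, fun V W _ hV U ε hε hεε₀ => ?_⟩
  obtain ⟨σ, N, hN, hσ⟩ := hgeneral V W hV U ε hε (hεε₀.trans hε₀'.le)
  refine ⟨σ, N, hN.trans ?_, hσ⟩
  rw [mul_assoc]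
  exact mul_le_mul_of_nonneg_left
    (PeerNet.mul_inv_le_mul_sq_mul_inv_mul_log_sq U.card hε hεε₀ hε₀') hK.le
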